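/- **Theorem.** Let $L$ be a countable first-order language (relation, constant and function symbols are allowed), and let $\mathfrak A$ be an $L$-structure with nonempty universe $A$ that is $\aleph_0$-categorical, i.e. $A$ is countable (finite or countably infinite) and every countable $L$-structure that satisfies the same first-order $L$-sentences as $\mathfrak A$ is isomorphic to $\mathfrak A$. Let $r\in\mathbb N$ and let $R\subseteq A^r$. Then $R$ is positive Horn definable in $\mathfrak A$ if and only if $R$ is preserved by all surjective periomorphisms of $\mathfrak A$. Here: - A *positive Horn formula* is a first-order $L$-formula built from atoms (equalities of terms, relation symbols applied to terms, and the propositional constant $\bot$ for falsehood) by means of conjunction, universal quantification and existential quantification. $R$ is *positive Horn definable in $\mathfrak A$* if $R=\{\bar a\in A^r : \mathfrak A\models\varphi(\bar a)\}$ for some positive Horn formula $\varphi(x_0,\dots,x_{r-1})$ without parameters. - A sequence $a:\mathbb N\to A$ is *periodic* if there is $k>0$ such that $a(i)=a(i \bmod k)$ for all $i\in\mathbb N$. The *periodic power* $\mathfrak A^{\mathrm{per}}$ is the substructure of the direct power $\mathfrak A^{\mathbb N}$ whose universe is the set $A^{\mathrm{per}}$ of all periodic sequences. - A *periomorphism*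 of $\mathfrak A$ is a homomorphism $h:\mathfrak A^{\mathrm{per}}\to\mathfrak A$. It *preserves* $R$ if for all $a_0,\dots,a_{r-1}\in A^{\mathrm{per}}$ such that $(a_0(i),\dots,a_{r-1}(i))\in R$ for every $i\in\mathbb N$, one has $(h(a_0),\dots,h(a_{r-1}))\in R$. -/

import Mathlib

open FirstOrder.Language

universe u v w

namespace PosHorn

/-- A structure `A` is `ℵ₀`-categorical if it is countable (finite or countably infinite) and every
countable structure satisfying the same first-order sentences is isomorphic to it. -/
def IsAleph0Categorical (L : FirstOrder.Language.{u, v}) (A : Type w) [L.Structure A] : Prop :=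
  Countable A ∧
    ∀ (B : Type w) [L.Structure B], Countable B → L.ElementarilyEquivalent A B →
      Nonempty (L.Equiv A B)

/-- Positive Horn formulas: formulas built from atoms (equalities of terms, relation symbols applied
to terms, and the propositional constant `⊥`) by means of conjunction and the two quantifiers. -/
inductive IsPositiveHorn {L : FirstOrder.Language.{u, v}} {α : Type} :
    ∀ {n : ℕ}, L.BoundedFormula α n → Prop
  | falsum {n : ℕ} : IsPositiveHorn (⊥ : L.BoundedFormula α n)
  | atomic {n : ℕ} {φ : L.BoundedFormula α n} (h : φ.IsAtomic) : IsPositiveHorn φ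
  | and {n : ℕ} {φ ψ : L.BoundedFormula α n} (hφ : IsPositiveHorn φ) (hψ : IsPositiveHorn ψ) :
      IsPositiveHorn (φ ⊓ ψ)
  | all {n : ℕ} {φ : L.BoundedFormula α (n + 1)} (h : IsPositiveHorn φ) : IsPositiveHorn φ.all
  | ex {n : ℕ} {φ : L.BoundedFormula α (n + 1)} (h : IsPositiveHorn φ) : IsPositiveHorn φ.ex

/-- An `r`-ary relation over `A` is positive Horn definable if it is the set of tuples that satisfy
some positive Horn formula (without parameters) in the variables `x₀, …, x_{r-1}`. -/
def PositiveHornDefinable (L : FirstOrder.Language.{u, v}) {A : Type w} [L.Structure A] {r : ℕ}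
    (R : Set (Fin r → A)) : Prop :=
  ∃ φ : L.Formula (Fin r), IsPositiveHorn φ ∧ ∀ a : Fin r → A, a ∈ R ↔ φ.Realize a

/-- The direct product of a family of structures: functions are computed, and relations are
required to hold, in every coordinate. -/
instance directProduct {L : FirstOrder.Language.{u, v}} {I : Type*} (A : I → Type w)
    [∀ i, L.Structure (A i)] :
    L.Structure (∀ i, A i) where
  funMap f x := fun i => Structure.funMap f (fun j => x j i)
  RelMap R x := ∀ i, Structure.RelMap R (fun j => x j i)

/-- A sequence `a` is periodic if, for some `k > 0`, `a i = a (i mod k)` for all `i`. -/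
def IsPeriodic {A : Type w} (a : ℕ → A) : Prop :=
  ∃ k : ℕ, 0 < k ∧ ∀ i : ℕ, a i = a (i % k)

/-- Finitely many periodic sequences have a common period. -/
theorem exists_common_period {A : Type w} {n : ℕ} (x : Fin n → ℕ → A)
    (hx : ∀ j, IsPeriodic (x j)) : ∃ k : ℕ, 0 < k ∧ ∀ j i, x j i = x j (i % k) := by
  choose k hk hki using hx
  refine ⟨∏ j, k j, Finset.prod_pos fun j _ => hk j, fun j i => ?_⟩
  rw [hki j i, hki j (i % ∏ j, k j),
    Nat.mod_mod_of_dvd i (Finset.dvd_prod_of_mem k (Finset.mem_univ j))]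

/-- The periodic power of `A`: the substructure of the direct power `A ^ ℕ` whose universe is the
set of periodic sequences. -/
def periodicPower (L : FirstOrder.Language.{u, v}) (A : Type w) [L.Structure A] :
    L.Substructure (ℕ → A) where
  carrier := {a | IsPeriodic a}
  fun_mem := by
    intro n f x hx
    obtain ⟨k, hk, hki⟩ := exists_common_period x hx
    refine ⟨k, hk, fun i => ?_⟩
    change Structure.funMap f (fun j => x j i) = Structure.funMap f (fun j => x j (i % k))
    exact congrArg _ (funext fun j => hki j i)

/-- A periomorphism of `A` is a homomorphism from the periodic power of `A` to `A`. -/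
abbrev Periomorphism (L : FirstOrder.Language.{u, v}) (A : Type w) [L.Structure A] : Type w :=
  L.Hom (periodicPower L A) A

/-- A periomorphism `h` preserves the `r`-ary relation `R` if, for all periodic sequences
`a₀, …, a_{r-1}` such that `(a₀ i, …, a_{r-1} i) ∈ R` for every `i`, also
`(h a₀, …, h a_{r-1}) ∈ R`. -/
def Periomorphism.Preserves {L : FirstOrder.Language.{u, v}} {A : Type w} [L.Structure A]
    (h : Periomorphism L A) {r : ℕ} (R : Set (Fin r → A)) : Prop :=
  ∀ a : Fin r → periodicPower L A,
    (∀ i : ℕ, (fun j => (a j : ℕ → A) i) ∈ R) → (fun j => h (a j)) ∈ R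

end PosHorn

/-!
The forward direction rests on `IsPositiveHorn.realize_periodicPower_iff`: a positive Horn formula
holds in the periodic power iff it holds in every coordinate. (Witnesses of an existential
quantifier can be chosen with a common period of the finitely many parameters.) Surjective
homomorphisms preserve positive formulas, so surjective periomorphisms preserve positive Horn
definable relations; categoricity plays no role here.

For the converse, the only consequence of `ℵ₀`-categoricity that is needed is the theorem of
Ryll-Nardzewski: there are only finitely many definable relations of each arity
(`IsAleph0Categorical.finite_definable`). It is proved semantically. Every countable elementary
extension of `A` is isomorphic to `A`, so `A` realizes all types over `∅`
(`IsAleph0Categorical.nonempty_sInter`, via an ultrapower). As `A ^ n` is countable, a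
diagonalization shows that every nonempty definable set contains a tuple of isolated type. Hence a
generic construction yields an elementary substructure in which all tuples are of isolated type; it
is isomorphic to `A`, so in `A` too all types are isolated, and finitely many complete definable
sets cover `A ^ n`.

Now let a nonempty `R` be preserved by all surjective periomorphisms. By finiteness, the conjunction
of all positive Horn formulas valid on `R` is equivalent to a single positive Horn formula `θ`, and
there are tuples in `R`, finite in number, that refute all positive Horn formulas not valid on `R`.
Repeating these tuples periodically gives a tuple `a` of periodic sequences that lies in `R` in each
coordinate. If `b` satisfies `θ`, then every positive Horn formula true of `a` in the periodic power
is true of `b` in `A`. This relation between tuples has the back-and-forth property: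
in the forth step (`HornTransfer.exists_snoc_right`) one existential formula describes the new
sequence; in the back step (`HornTransfer.exists_snoc_left`) a new sequence is assembled that
refutes, each in its own coordinate, all the finitely many positive Horn formulas it has to refute.
In the limit, a surjective periomorphism maps `a` to `b`, whence `b ∈ R`.
-/

namespace PosHorn

variable {L : FirstOrder.Language.{u, v}} {A : Type w} [L.Structure A]

/-! ### Realizing types in `ℵ₀`-categorical structures -/

theorem exists_countable_elementarySubstructure [Countable L.Symbols] (s : Set A)
    (hs : s.Countable) : ∃ S : L.ElementarySubstructure A, s ⊆ S ∧ Countable S := by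
  by_cases hA : Countable A
  · exact ⟨⊤, fun _ _ => trivial, inferInstance⟩
  · obtain ⟨S, hS, hc⟩ := exists_elementarySubstructure_card_eq L s Cardinal.aleph0.{0} le_rfl
      (by simpa using hs.le_aleph0)
      (by simpa [FirstOrder.Language.card] using Cardinal.mk_le_aleph0 (α := L.Symbols))
      (by
        have : ¬ Cardinal.mk A ≤ Cardinal.aleph0 := fun h => hA (Cardinal.mk_le_aleph0_iff.1 h)
        simpa using (not_le.1 this).le)
    refine ⟨S, hS, Cardinal.mk_le_aleph0_iff.1 ?_⟩
    have : Cardinal.mk S = Cardinal.aleph0 := by simpa using hc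
    exact this.le

/-- An `ℵ₀`-categorical structure realizes every set of definable relations that is finitely
satisfiable in it: a countable elementary substructure of a suitable ultrapower does so and is
isomorphic to `A`. -/
theorem IsAleph0Categorical.nonempty_sInter [Countable L.Symbols] [Nonempty A]
    (hA : IsAleph0Categorical L A) {n : ℕ} (Γ : Set (Set (Fin n → A)))
    (hdef : ∀ D ∈ Γ, (∅ : Set A).Definable L D)
    (hfip : ∀ F ⊆ Γ, F.Finite → (⋂₀ F).Nonempty) : (⋂₀ Γ).Nonempty := by
  have hne : (Filter.generate Γ).NeBot :=
    Filter.generate_neBot_iff.2 fun F hF hfin => hfip F hF hfin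
  let U : Ultrafilter (Fin n → A) := Ultrafilter.of (Filter.generate Γ)
  have hU : ∀ D ∈ Γ, D ∈ U := fun D hD =>
    Ultrafilter.of_le _ (Filter.GenerateSets.basic hD)
  let N := (U : Filter (Fin n → A)).Product fun _ => A
  let x : Fin n → N := fun j => ((fun g => g j : (Fin n → A) → A) : N)
  have hAN : L.ElementarilyEquivalent A N := elementarilyEquivalent_iff.2 fun φ =>
    ((Ultraproduct.sentence_realize (M := fun _ : Fin n → A => A) (u := U) φ).trans
      Filter.eventually_const).symm
  obtain ⟨S, hxS, hS⟩ := exists_countable_elementarySubstructure (L := L) (Set.range x)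
    (Set.countable_range x)
  obtain ⟨e⟩ := hA.2 S hS (hAN.trans S.elementarilyEquivalent.symm)
  let y : Fin n → S := fun j => ⟨x j, hxS ⟨j, rfl⟩⟩
  refine ⟨fun j => e.symm (y j), fun D hD => ?_⟩
  obtain ⟨φ, rfl⟩ := Set.empty_definable_iff.1 (hdef D hD)
  have h1 : φ.Realize x := (Ultraproduct.realize_formula_cast (M := fun _ : Fin n → A => A)
    (u := U) φ (fun j g => g j)).2 (hU _ hD)
  have h2 : φ.Realize y := (S.subtype.map_formula φ y).1 h1
  exact (StrongHomClass.realize_formula e.symm φ).2 h2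

/-! ### Tuples of isolated type and the Ryll-Nardzewski theorem -/

/-- A complete set is a `∅`-definable set not split by any other one; it is empty or the set of
realizations of an isolated `n`-type. -/
def IsCompleteSet (L : FirstOrder.Language.{u, v}) [L.Structure A] {n : ℕ}
    (E : Set (Fin n → A)) : Prop :=
  (∅ : Set A).Definable L E ∧ ∀ D, (∅ : Set A).Definable L D → E ⊆ D ∨ Disjoint E D

/-- A tuple is isolated if some formula true of it implies every formula true of it, that is, if its
type over `∅` is isolated. -/
def IsIsolated (L : FirstOrder.Language.{u, v}) [L.Structure A] {n : ℕ} (a : Fin n → A) : Prop :=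
  ∃ E, IsCompleteSet L E ∧ a ∈ E

/-- Tuples of isolated type are dense. Otherwise one can shrink a definable set without such tuples
along an enumeration `t` of `A ^ n`, excluding `t k` in step `k`; the resulting decreasing sequence
would have a common point. -/
theorem IsAleph0Categorical.exists_isIsolated_mem [Countable L.Symbols] [Nonempty A]
    (hA : IsAleph0Categorical L A) {n : ℕ} {D : Set (Fin n → A)}
    (hD : (∅ : Set A).Definable L D) (hne : D.Nonempty) : ∃ a ∈ D, IsIsolated L a := by
  by_contra! hcon
  have : Countable A := hA.1
  obtain ⟨t, ht⟩ := exists_surjective_nat (Fin n → A)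
  let P := {E : Set (Fin n → A) // (∅ : Set A).Definable L E ∧ E.Nonempty ∧ E ⊆ D}
  have step : ∀ (k : ℕ) (E : P), ∃ F : P, F.1 ⊆ E.1 ∧ t k ∉ F.1 := by
    rintro k ⟨E, hE, ⟨a, ha⟩, hED⟩
    have hnc : ¬ IsCompleteSet L E := fun h => hcon a (hED ha) ⟨E, h, ha⟩
    simp only [IsCompleteSet, hE, true_and, not_forall, not_or] at hnc
    obtain ⟨G, hG, hsub, hdis⟩ := hnc
    obtain ⟨b, hb, hbG⟩ := Set.not_subset.1 hsub
    obtain ⟨c, hc, hcG⟩ := Set.not_disjoint_iff.1 hdis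
    by_cases htG : t k ∈ G
    · exact ⟨⟨E ∩ Gᶜ, hE.inter hG.compl, ⟨b, hb, hbG⟩, fun z hz => hED hz.1⟩,
        Set.inter_subset_left, fun h => h.2 htG⟩
    · exact ⟨⟨E ∩ G, hE.inter hG, ⟨c, hc, hcG⟩, fun z hz => hED hz.1⟩,
        Set.inter_subset_left, fun h => htG h.2⟩
  choose next hsub hnot using step
  let s : ℕ → P := fun k => Nat.rec ⟨D, hD, hne, subset_rfl⟩ next k
  have hanti : Antitone fun k => (s k).1 := antitone_nat_of_succ_le fun k => hsub k (s k)
  obtain ⟨a, ha⟩ := hA.nonempty_sInter (Set.range fun k => (s k).1)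
    (by rintro _ ⟨k, rfl⟩; exact (s k).2.1) (by
      intro F hF hfin
      obtain ⟨K, hK⟩ : ∃ K, ∀ G ∈ F, (s K).1 ⊆ G := by
        refine hfin.induction_on_subset (motive := fun F _ => ∃ K, ∀ G ∈ F, (s K).1 ⊆ G) _
          ⟨0, by simp⟩ ?_
        rintro G T hG _ _ ⟨K, hK⟩
        obtain ⟨k, rfl⟩ := hF hG
        refine ⟨max k K, ?_⟩
        rintro G (rfl | hG)
        · exact hanti (le_max_left _ _)
        · exact (hanti (le_max_right _ _)).trans (hK G hG)
      obtain ⟨z, hz⟩ := (s K).2.2.1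
      exact ⟨z, fun G hG => hK G hG hz⟩)
  obtain ⟨k, rfl⟩ := ht a
  exact hnot k (s k) (ha _ ⟨k + 1, rfl⟩)

theorem IsCompleteSet.image_comp {m n : ℕ} {E : Set (Fin n → A)} (hE : IsCompleteSet L E)
    (f : Fin m → Fin n) : IsCompleteSet L ((fun g : Fin n → A => g ∘ f) '' E) := by
  refine ⟨hE.1.image_comp f, fun D hD => ?_⟩
  refine (hE.2 _ (hD.preimage_comp f)).imp (fun h => Set.image_subset_iff.2 h) fun h => ?_
  rw [Set.disjoint_left] at h ⊢
  rintro _ ⟨g, hg, rfl⟩ hgD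
  exact h hg hgD

theorem IsIsolated.comp {m n : ℕ} {a : Fin n → A} (ha : IsIsolated L a) (f : Fin m → Fin n) :
    IsIsolated L (a ∘ f) := by
  obtain ⟨E, hE, haE⟩ := ha
  exact ⟨_, hE.image_comp f, a, haE, rfl⟩

/-- Density of isolated types over an isolated tuple `a`: the projection of a complete set contains
the whole complete set of `a` as soon as it meets it. -/
theorem IsAleph0Categorical.exists_isIsolated_snoc [Countable L.Symbols] [Nonempty A]
    (hA : IsAleph0Categorical L A) {n : ℕ} {a : Fin n → A} (ha : IsIsolated L a)
    {D : Set (Fin (n + 1) → A)} (hD : (∅ : Set A).Definable L D) {y : A}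
    (hy : (Fin.snoc a y : Fin (n + 1) → A) ∈ D) :
    ∃ z, (Fin.snoc a z : Fin (n + 1) → A) ∈ D ∧
      IsIsolated L (Fin.snoc a z : Fin (n + 1) → A) := by
  obtain ⟨E, hE, haE⟩ := ha
  obtain ⟨g, ⟨hgD, hgE⟩, F, hF, hgF⟩ := hA.exists_isIsolated_mem
    (hD.inter (hE.1.preimage_comp Fin.castSucc))
    ⟨_, hy, by simpa [Function.comp_def] using haE⟩
  have hFD : F ⊆ D := (hF.2 D hD).resolve_right fun h => Set.disjoint_left.1 h hgF hgD
  have hEF : E ⊆ (fun g : Fin (n + 1) → A => g ∘ Fin.castSucc) '' F :=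
    (hE.2 _ (hF.1.image_comp Fin.castSucc)).resolve_right fun h =>
      Set.disjoint_left.1 h hgE ⟨g, hgF, rfl⟩
  obtain ⟨g', hg', rfl⟩ := hEF haE
  have hsnoc : (Fin.snoc (g' ∘ Fin.castSucc) (g' (Fin.last n)) : Fin (n + 1) → A) = g' :=
    Fin.snoc_init_self g'
  exact ⟨g' (Fin.last n), by rw [hsnoc]; exact hFD hg', by rw [hsnoc]; exact ⟨F, hF, hg'⟩⟩

theorem definable_realize {n : ℕ} (φ : L.BoundedFormula Empty n) :
    (∅ : Set A).Definable L {g : Fin n → A | φ.Realize default g} := by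
  refine Set.empty_definable_iff.2 ⟨φ.toFormula.relabel (Sum.elim Empty.elim id), ?_⟩
  ext g
  simp only [Set.mem_ofPred_eq, FirstOrder.Language.Formula.realize_relabel,
    BoundedFormula.realize_toFormula]
  rw [iff_iff_eq]
  congr 1
  exact Subsingleton.elim _ _

theorem exists_mem_ideal_forall_le {P ι : Type*} [Preorder P] [Finite ι] (I : Order.Ideal P)
    (p : ι → P) (hp : ∀ i, p i ∈ I) : ∃ q ∈ I, ∀ i, p i ≤ q := by
  have : Nonempty I := I.nonempty.to_subtype
  obtain ⟨q, hq⟩ := (I.directed.directed_val).finite_le fun i => (⟨p i, hp i⟩ : I)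
  exact ⟨q, q.2, hq⟩

/-- The substructure is the union of a generic ideal in the preorder of tuples of isolated type,
where genericity amounts to the Tarski-Vaught test. -/
theorem IsAleph0Categorical.exists_atomic_elementarySubstructure [Countable L.Symbols] [Nonempty A]
    (hA : IsAleph0Categorical L A) : ∃ S : L.ElementarySubstructure A,
      ∀ (n : ℕ) (x : Fin n → S), IsIsolated L (fun i => (x i : A)) := by
  have : Countable A := hA.1
  let P := {p : Σ n, Fin n → A // IsIsolated L p.2}
  let rng : P → Set A := fun p => Set.range p.1.2
  let : Preorder P := Preorder.lift rng
  obtain ⟨a₀, -, ha₀⟩ := hA.exists_isIsolated_mem (n := 0) (L := L) Set.definable_univ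
    Set.univ_nonempty
  let p₀ : P := ⟨⟨0, a₀⟩, ha₀⟩
  let ι := Σ m, L.BoundedFormula Empty (m + 1) × (Fin m → A)
  have hφc : ∀ m, Countable (L.BoundedFormula Empty m) := fun m =>
    (sigma_mk_injective (i := m) (β := fun k => L.BoundedFormula Empty k)).countable
  have : Countable ι := inferInstance
  let : Encodable ι := Encodable.ofCountable ι
  -- Parameters may be missing from `p` and still occur in later states; therefore the condition
  -- excludes them from all extensions of `p` unless `p` contains a witness.
  let 𝒟 : ι → Order.Cofinal P := fun i =>
    { carrier := {p | (∃ b, i.2.1.Realize default (Fin.snoc i.2.2 b)) →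
        (∀ q, p ≤ q → ¬ Set.range i.2.2 ⊆ rng q) ∨
          ∃ b ∈ rng p, i.2.1.Realize default (Fin.snoc i.2.2 b)}
      isCofinal := by
        obtain ⟨m, φ, x⟩ := i
        intro p
        by_cases hp : (∃ b, φ.Realize default (Fin.snoc x b)) ∧
            ∃ q, p ≤ q ∧ Set.range x ⊆ rng q
        · obtain ⟨⟨b, hb⟩, ⟨⟨n, a⟩, ha⟩, hpq, hx⟩ := hp
          choose e he using fun i => hx ⟨i, rfl⟩
          obtain rfl : a ∘ e = x := funext he
          let e' : Fin (m + 1) → Fin (n + 1) := Fin.snoc (Fin.castSucc ∘ e) (Fin.last n)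
          have he' : ∀ z, (Fin.snoc a z : Fin (n + 1) → A) ∘ e' = Fin.snoc (a ∘ e) z := by
            intro z
            funext i
            induction i using Fin.lastCases <;> simp [e']
          obtain ⟨z, hz, hiso⟩ := hA.exists_isIsolated_snoc ha
            ((definable_realize φ).preimage_comp e') (y := b) (by
              rw [Set.mem_preimage, he']
              exact hb)
          refine ⟨⟨⟨n + 1, Fin.snoc a z⟩, hiso⟩, fun _ => Or.inr ⟨z, ⟨Fin.last n, by simp⟩, ?_⟩,
            hpq.trans ?_⟩
          · rw [Set.mem_preimage, he'] at hz
            exact hz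
          · rintro _ ⟨i, rfl⟩
            exact ⟨i.castSucc, by simp⟩
        · exact ⟨p, fun h => Or.inl fun q hq hx => hp ⟨h, q, hq, hx⟩, le_rfl⟩ }
  let I := Order.idealOfCofinals p₀ 𝒟
  -- By directedness, a finite tuple of elements occurs in a single state.
  have hfin : ∀ (n : ℕ) (x : Fin n → A), (∀ i, ∃ p ∈ I, x i ∈ rng p) →
      ∃ p ∈ I, Set.range x ⊆ rng p := by
    intro n x hx
    choose p hpI hxp using hx
    obtain ⟨q, hq, hpq⟩ := exists_mem_ideal_forall_le I p hpI
    refine ⟨q, hq, ?_⟩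
    rintro _ ⟨i, rfl⟩
    exact hpq i (hxp i)
  have hwit : ∀ (n : ℕ) (φ : L.BoundedFormula Empty (n + 1)) (x : Fin n → A) (a : A),
      (∀ i, ∃ p ∈ I, x i ∈ rng p) → φ.Realize default (Fin.snoc x a) →
        ∃ b, (∃ p ∈ I, b ∈ rng p) ∧ φ.Realize default (Fin.snoc x b) := by
    intro n φ x a hx ha
    obtain ⟨p, hpI, hp⟩ := hfin n x hx
    obtain ⟨q, hq, hqI⟩ := Order.cofinal_meets_idealOfCofinals p₀ 𝒟 ⟨n, φ, x⟩
    obtain ⟨r, hrI, hpr, hqr⟩ := I.directed p hpI q hqI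
    rcases hq ⟨a, ha⟩ with hq | ⟨b, hb, hφ⟩
    · exact absurd (hp.trans hpr) (hq r hqr)
    · exact ⟨b, ⟨q, hqI, hb⟩, hφ⟩
  let S : L.Substructure A :=
    { carrier := {c | ∃ p ∈ I, c ∈ rng p}
      fun_mem := by
        intro n f x hx
        obtain ⟨b, hb, hφ⟩ := hwit n
          (Term.bdEqual (Term.func f fun i => Term.var (Sum.inr i.castSucc))
            (Term.var (Sum.inr (Fin.last n)))) x (Structure.funMap f x) hx (by
              simp [BoundedFormula.realize_bdEqual])
        obtain rfl : Structure.funMap f x = b := by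
          simpa [BoundedFormula.realize_bdEqual] using hφ
        exact hb }
  refine ⟨S.toElementarySubstructure ?_, ?_⟩
  · intro n φ x a hφ
    obtain ⟨b, hb, hφb⟩ := hwit n φ (fun i => x i) a (fun i => (x i).2) hφ
    exact ⟨⟨b, hb⟩, hφb⟩
  · intro n x
    obtain ⟨⟨⟨m, a⟩, ha⟩, -, hp⟩ := hfin n (fun i => x i) fun i => (x i).2
    choose e he using fun i => hp ⟨i, rfl⟩
    have hx : (fun i => (x i : A)) = a ∘ e := (funext he).symm
    rw [hx]
    exact ha.comp e

theorem IsIsolated.of_elementaryEmbedding {B : Type w} [L.Structure B]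
    (f : L.ElementaryEmbedding A B) {n : ℕ} {a : Fin n → A} (h : IsIsolated L (f ∘ a)) :
    IsIsolated L a := by
  obtain ⟨E, ⟨hE, hcomp⟩, haE⟩ := h
  obtain ⟨φ, rfl⟩ := Set.empty_definable_iff.1 hE
  refine ⟨{g | φ.Realize g}, ⟨Set.empty_definable_iff.2 ⟨φ, rfl⟩, fun D hD => ?_⟩,
    (f.map_formula φ _).1 haE⟩
  obtain ⟨ψ, rfl⟩ := Set.empty_definable_iff.1 hD
  refine (hcomp {g | ψ.Realize g} (Set.empty_definable_iff.2 ⟨ψ, rfl⟩)).imp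
    (fun h g hg => ?_) fun h => Set.disjoint_left.2 fun g hg hgD => ?_
  · exact (f.map_formula ψ g).1 (h ((f.map_formula φ g).2 hg))
  · exact Set.disjoint_left.1 h ((f.map_formula φ g).2 hg) ((f.map_formula ψ g).2 hgD)

theorem IsAleph0Categorical.isIsolated [Countable L.Symbols] [Nonempty A]
    (hA : IsAleph0Categorical L A) {n : ℕ} (a : Fin n → A) : IsIsolated L a := by
  have : Countable A := hA.1
  obtain ⟨S, hS⟩ := hA.exists_atomic_elementarySubstructure
  obtain ⟨e⟩ := hA.2 S inferInstance S.elementarilyEquivalent.symm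
  exact (hS n (e ∘ a)).of_elementaryEmbedding (S.subtype.comp e.toElementaryEmbedding)

/-- **Ryll-Nardzewski theorem**: an `ℵ₀`-categorical structure has finitely many definable relations
of each arity. Since the complements of complete sets have no common point, finitely many complete
sets cover `A ^ n`, and each definable set is a union of these. -/
theorem IsAleph0Categorical.finite_definable [Countable L.Symbols] [Nonempty A]
    (hA : IsAleph0Categorical L A) (n : ℕ) :
    {D : Set (Fin n → A) | (∅ : Set A).Definable L D}.Finite := by
  obtain ⟨F, hF, hfin, hempty⟩ : ∃ F ⊆ {D : Set (Fin n → A) | IsCompleteSet L Dᶜ}, F.Finite ∧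
      ⋂₀ F = ∅ := by
    by_contra! hcon
    obtain ⟨a, ha⟩ := hA.nonempty_sInter {D : Set (Fin n → A) | IsCompleteSet L Dᶜ}
      (fun D hD => by simpa using hD.1.compl)
      fun F hF hfin => hcon F hF hfin
    obtain ⟨E, hE, haE⟩ := hA.isIsolated a
    exact ha Eᶜ (by simpa using hE) haE
  -- A definable set is the union of the complete sets `Gᶜ`, `G ∈ F`, that it contains.
  refine Set.Finite.of_finite_image (f := fun D => {G ∈ F | Gᶜ ⊆ D})
    (hfin.finite_subsets.subset ?_) ?_
  · rintro _ ⟨D, -, rfl⟩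
    exact Set.sep_subset _ _
  · have key : ∀ D D' : Set (Fin n → A), (∅ : Set A).Definable L D →
        {G ∈ F | Gᶜ ⊆ D} = {G ∈ F | Gᶜ ⊆ D'} → D ⊆ D' := by
      intro D D' hD h a haD
      obtain ⟨G, hG, haG⟩ : ∃ G ∈ F, a ∉ G := by
        by_contra! hall
        exact Set.notMem_empty a (hempty ▸ hall)
      have hGD : Gᶜ ⊆ D :=
        ((hF hG).2 D hD).resolve_right fun hdis => Set.disjoint_left.1 hdis haG haD
      have hG' : G ∈ {G ∈ F | Gᶜ ⊆ D'} := h ▸ ⟨hG, hGD⟩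
      exact hG'.2 haG
    exact fun D hD D' hD' h => (key D D' hD h).antisymm (key D' D hD' h.symm)

/-! ### Positive Horn formulas in the periodic power -/

theorem exists_common_period_of_finite {ι : Type*} [Finite ι] (x : ι → periodicPower L A) :
    ∃ k : ℕ, 0 < k ∧ ∀ j i, (x j : ℕ → A) i = (x j : ℕ → A) (i % k) := by
  obtain ⟨n, ⟨e⟩⟩ := Finite.exists_equiv_fin ι
  obtain ⟨k, hk, h⟩ := exists_common_period (fun j => (x (e.symm j) : ℕ → A))
    fun j => (x (e.symm j)).2
  exact ⟨k, hk, fun j i => by simpa using h (e j) i⟩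

theorem coe_realize_term_periodicPower {β : Type*} (t : L.Term β) (x : β → periodicPower L A)
    (i : ℕ) :
    ((t.realize x : periodicPower L A) : ℕ → A) i = t.realize fun j => (x j : ℕ → A) i := by
  induction t with
  | var => rfl
  | func f ts ih => exact congrArg _ (funext ih)

theorem coe_snoc_periodicPower {n : ℕ} (x : Fin n → periodicPower L A) (c : periodicPower L A)
    (i : ℕ) :
    (fun j => ((Fin.snoc x c : Fin (n + 1) → periodicPower L A) j : ℕ → A) i) =
      Fin.snoc (fun j => (x j : ℕ → A) i) ((c : ℕ → A) i) := by
  funext j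
  induction j using Fin.lastCases <;> simp

/-- The sequence that repeats the first `k` entries of `c`. -/
def repeatFirst (L : FirstOrder.Language.{u, v}) [L.Structure A] (k : ℕ) (hk : 0 < k)
    (c : ℕ → A) : periodicPower L A :=
  ⟨fun i => c (i % k), k, hk, fun i => by simp⟩

/-- The existential step makes the choice of witnesses depend only on the residue of the coordinate
modulo a common period of the parameters; `⊥` is covered because there is at least one coordinate. -/
theorem IsPositiveHorn.realize_periodicPower_iff {α : Type} [Finite α] {n : ℕ}
    {φ : L.BoundedFormula α n} (hφ : IsPositiveHorn φ) (a : α → periodicPower L A)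
    (x : Fin n → periodicPower L A) :
    φ.Realize a x ↔
      ∀ i : ℕ, φ.Realize (fun j => (a j : ℕ → A) i) (fun j => (x j : ℕ → A) i) := by
  have helim : ∀ {n : ℕ} (x : Fin n → periodicPower L A) (i : ℕ),
      (fun j => ((Sum.elim a x j : periodicPower L A) : ℕ → A) i) =
        Sum.elim (fun j => (a j : ℕ → A) i) fun j => (x j : ℕ → A) i := by
    intro n x i
    funext j
    cases j <;> rfl
  induction hφ with
  | falsum => exact ⟨fun h => h.elim, fun h => (h 0).elim⟩
  | atomic h =>
    induction h with
    | equal t₁ t₂ =>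
      simp only [BoundedFormula.realize_bdEqual, Subtype.ext_iff, funext_iff,
        coe_realize_term_periodicPower, helim]
    | rel R ts =>
      simp only [BoundedFormula.realize_rel]
      have : ∀ i, (fun j => (((ts j).realize (Sum.elim a x) : periodicPower L A) : ℕ → A) i) =
          fun j => (ts j).realize (Sum.elim (fun j => (a j : ℕ → A) i) fun j => (x j : ℕ → A) i) := by
        intro i
        simp only [coe_realize_term_periodicPower, helim]
      simp only [← this]
      rfl
  | and _ _ ih₁ ih₂ => simp only [BoundedFormula.realize_inf, ih₁, ih₂, forall_and]
  | all _ ih =>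
    simp only [BoundedFormula.realize_all, ih, coe_snoc_periodicPower]
    -- Universal quantifiers are tested on constant sequences.
    exact ⟨fun h i y => h (repeatFirst L 1 one_pos fun _ => y) i, fun h c i => h i _⟩
  | ex _ ih =>
    simp only [BoundedFormula.realize_ex, ih, coe_snoc_periodicPower]
    refine ⟨fun ⟨c, hc⟩ i => ⟨_, hc i⟩, fun h => ?_⟩
    choose c hc using h
    obtain ⟨k, hk, hper⟩ := exists_common_period_of_finite (Sum.elim a x)
    refine ⟨repeatFirst L k hk c, fun i => ?_⟩
    have ha : (fun j => (a j : ℕ → A) i) = fun j => (a j : ℕ → A) (i % k) :=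
      funext fun j => hper (Sum.inl j) i
    have hx : (fun j => (x j : ℕ → A) i) = fun j => (x j : ℕ → A) (i % k) :=
      funext fun j => hper (Sum.inr j) i
    rw [ha, hx]
    exact hc (i % k)

/-- Positive formulas are preserved by surjective homomorphisms. -/
theorem IsPositiveHorn.realize_of_surjective {B C : Type*} [L.Structure B] [L.Structure C]
    {α : Type} {n : ℕ} {φ : L.BoundedFormula α n} (hφ : IsPositiveHorn φ) (h : L.Hom B C)
    (hh : Function.Surjective h) {a : α → B} {x : Fin n → B} (hx : φ.Realize a x) :
    φ.Realize (h ∘ a) (h ∘ x) := by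
  induction hφ with
  | falsum => exact hx
  | atomic hat =>
    induction hat with
    | equal t₁ t₂ =>
      rw [BoundedFormula.realize_bdEqual] at hx ⊢
      rw [← Sum.comp_elim, HomClass.realize_term, HomClass.realize_term, hx]
    | rel R ts =>
      rw [BoundedFormula.realize_rel] at hx ⊢
      simp only [← Sum.comp_elim, HomClass.realize_term]
      exact h.map_rel R _ hx
  | and _ _ ih₁ ih₂ =>
    rw [BoundedFormula.realize_inf] at hx ⊢
    exact hx.imp ih₁ ih₂
  | all _ ih =>
    rw [BoundedFormula.realize_all] at hx ⊢
    intro c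
    obtain ⟨b, rfl⟩ := hh c
    rw [← Fin.comp_snoc]
    exact ih (hx b)
  | ex _ ih =>
    rw [BoundedFormula.realize_ex] at hx ⊢
    obtain ⟨b, hb⟩ := hx
    refine ⟨h b, ?_⟩
    rw [← Fin.comp_snoc]
    exact ih hb

theorem PositiveHornDefinable.preserves {r : ℕ} {R : Set (Fin r → A)}
    (hR : PositiveHornDefinable L R) (h : Periomorphism L A) (hh : Function.Surjective h) :
    h.Preserves R := by
  obtain ⟨φ, hφ, hφR⟩ := hR
  intro a ha
  rw [hφR]
  have h1 : φ.Realize a := (hφ.realize_periodicPower_iff a default).2 fun i => by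
    rw [Subsingleton.elim (fun j => ((default : Fin 0 → periodicPower L A) j : ℕ → A) i) default]
    exact (hφR _).1 (ha i)
  have h2 := hφ.realize_of_surjective h hh h1
  rwa [Subsingleton.elim (h ∘ default) default] at h2

theorem exists_periodic_range_eq {X : Type*} {S : Set X} (hS : S.Finite) (hne : S.Nonempty) :
    ∃ (k : ℕ) (s : ℕ → X), 0 < k ∧ (∀ i, s i = s (i % k)) ∧ Set.range s = S := by
  have := hne.to_subtype
  have := hS.to_subtype
  obtain ⟨n, ⟨e⟩⟩ := Finite.exists_equiv_fin S
  have hn : 0 < n := Fin.pos_iff_nonempty.2 ⟨e hne.to_subtype.some⟩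
  refine ⟨n, fun i => e.symm ⟨i % n, Nat.mod_lt _ hn⟩, hn, fun i => by simp, ?_⟩
  ext x
  constructor
  · rintro ⟨i, rfl⟩
    exact (e.symm _).2
  · intro hx
    exact ⟨e ⟨x, hx⟩, by simp [Nat.mod_eq_of_lt (e ⟨x, hx⟩).2]⟩

/-! ### Finitely many formulas up to equivalence -/

theorem IsAleph0Categorical.exists_finite_representatives [Countable L.Symbols] [Nonempty A]
    (hA : IsAleph0Categorical L A) {r n : ℕ} (Φ : Set (L.BoundedFormula (Fin r) n)) :
    ∃ F ⊆ Φ, F.Finite ∧ ∀ φ ∈ Φ, ∃ ψ ∈ F, ∀ (v : Fin r → A) (x : Fin n → A),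
      φ.Realize v x ↔ ψ.Realize v x := by
  let D : L.BoundedFormula (Fin r) n → Set (Fin (r + n) → A) := fun φ =>
    {g | φ.Realize (g ∘ Fin.castAdd n) (g ∘ Fin.natAdd r)}
  have hD : ∀ φ, (∅ : Set A).Definable L (D φ) := fun φ => by
    refine Set.empty_definable_iff.2 ⟨φ.toFormula.relabel finSumFinEquiv, ?_⟩
    ext g
    change _ ↔ (φ.toFormula.relabel finSumFinEquiv).Realize g
    rw [FirstOrder.Language.Formula.realize_relabel, BoundedFormula.realize_toFormula]
    rfl
  obtain ⟨F, hF, hbij⟩ := Set.exists_subset_bijOn Φ D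
  refine ⟨F, hF, hbij.finite_iff_finite.2 ((hA.finite_definable (r + n)).subset ?_), ?_⟩
  · rintro _ ⟨φ, -, rfl⟩
    exact hD φ
  · intro φ hφ
    obtain ⟨ψ, hψ, h⟩ := hbij.surjOn ⟨φ, hφ, rfl⟩
    refine ⟨ψ, hψ, fun v x => ?_⟩
    have := Set.ext_iff.1 h (Fin.append v x)
    simpa [D, Function.comp_def] using this.symm

/-- In an `ℵ₀`-categorical structure, positive Horn formulas are closed under arbitrary conjunctions,
up to equivalence. -/
theorem IsAleph0Categorical.exists_isPositiveHorn_realize_iff_forall [Countable L.Symbols]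
    [Nonempty A] (hA : IsAleph0Categorical L A) {r n : ℕ} (Φ : Set (L.BoundedFormula (Fin r) n))
    (hΦ : ∀ φ ∈ Φ, IsPositiveHorn φ) :
    ∃ θ : L.BoundedFormula (Fin r) n, IsPositiveHorn θ ∧ ∀ (v : Fin r → A) (x : Fin n → A),
      θ.Realize v x ↔ ∀ φ ∈ Φ, φ.Realize v x := by
  obtain ⟨F, hF, hfin, hrep⟩ := hA.exists_finite_representatives Φ
  obtain ⟨θ, hθ, h⟩ : ∃ θ : L.BoundedFormula (Fin r) n, IsPositiveHorn θ ∧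
      ∀ (v : Fin r → A) (x : Fin n → A), θ.Realize v x ↔ ∀ φ ∈ F, φ.Realize v x := by
    refine hfin.induction_on_subset (motive := fun F _ => ∃ θ : L.BoundedFormula (Fin r) n,
      IsPositiveHorn θ ∧ ∀ (v : Fin r → A) (x : Fin n → A),
        θ.Realize v x ↔ ∀ φ ∈ F, φ.Realize v x) _ ?_ ?_
    · -- `⊤` is not a positive Horn formula, but `∀ y, y = y` is.
      exact ⟨(Term.bdEqual (Term.var (Sum.inr (Fin.last n)))
        (Term.var (Sum.inr (Fin.last n)))).all, .all (.atomic (.equal _ _)), fun v x => by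
          simp [BoundedFormula.realize_bdEqual]⟩
    · rintro φ T hφ _ _ ⟨θ, hθ, h⟩
      exact ⟨φ ⊓ θ, .and (hΦ φ (hF hφ)) hθ, fun v x => by
        simp [BoundedFormula.realize_inf, h]⟩
  refine ⟨θ, hθ, fun v x => (h v x).trans ⟨fun hall φ hφ => ?_, fun hall φ hφ => hall φ (hF hφ)⟩⟩
  obtain ⟨ψ, hψ, hiff⟩ := hrep φ hφ
  exact (hiff v x).2 (hall ψ hψ)

/-! ### Back and forth between the periodic power and the structure -/

/-- Every positive Horn formula true of `a, x` in the periodic power is true of `b, y` in `A`. The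
tuples `a`, `b` are fixed throughout the back-and-forth construction and interpret the free
variables, whereas `x`, `y` grow and interpret the de Bruijn variables, so that the quantifiers
`BoundedFormula.all` and `BoundedFormula.ex` act on the last entry of `x`, `y`. -/
def HornTransfer {r : ℕ} (a : Fin r → periodicPower L A) (b : Fin r → A) {n : ℕ}
    (x : Fin n → periodicPower L A) (y : Fin n → A) : Prop :=
  ∀ φ : L.BoundedFormula (Fin r) n, IsPositiveHorn φ → φ.Realize a x → φ.Realize b y

section

variable [Countable L.Symbols] [Nonempty A] {r n : ℕ} {a : Fin r → periodicPower L A}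
  {b : Fin r → A} {x : Fin n → periodicPower L A} {y : Fin n → A}

/-- The forth step: the conjunction `θ` of all positive Horn formulas true of `x` and `c` is positive
Horn, so that `∃ c, θ` transfers to `y`. -/
theorem HornTransfer.exists_snoc_right (hA : IsAleph0Categorical L A)
    (h : HornTransfer a b x y) (c : periodicPower L A) :
    ∃ d : A, HornTransfer a b (Fin.snoc x c : Fin (n + 1) → _) (Fin.snoc y d : Fin (n + 1) → A) := by
  obtain ⟨θ, hθ, hiff⟩ := hA.exists_isPositiveHorn_realize_iff_forall
    {φ : L.BoundedFormula (Fin r) (n + 1) | IsPositiveHorn φ ∧ φ.Realize a (Fin.snoc x c)}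
    fun φ hφ => hφ.1
  have hθx : θ.Realize a (Fin.snoc x c) := (hθ.realize_periodicPower_iff _ _).2 fun i =>
    (hiff _ _).2 fun φ hφ => (hφ.1.realize_periodicPower_iff _ _).1 hφ.2 i
  obtain ⟨d, hd⟩ := BoundedFormula.realize_ex.1
    (h θ.ex hθ.ex (BoundedFormula.realize_ex.2 ⟨c, hθx⟩))
  exact ⟨d, fun φ hφ hφx => (hiff _ _).1 hd φ ⟨hφ, hφx⟩⟩

/-- The back step. Let `F` represent the positive Horn formulas false at `y, d`. For each `φ ∈ F`, the
formula `∀ d, φ` is false at `y`, hence at `x`, hence fails in some coordinate `i` with some value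
`e`; `q φ` is such a pair `(i, e)`. Because `x` is periodic, that coordinate recurs, so a single
periodic sequence `c` can use all these values and thus refute all of `F`. -/
theorem HornTransfer.exists_snoc_left (hA : IsAleph0Categorical L A)
    (h : HornTransfer a b x y) (d : A) :
    ∃ c : periodicPower L A,
      HornTransfer a b (Fin.snoc x c : Fin (n + 1) → _) (Fin.snoc y d : Fin (n + 1) → A) := by
  obtain ⟨F, hF, hfin, hrep⟩ := hA.exists_finite_representatives
    {φ : L.BoundedFormula (Fin r) (n + 1) | IsPositiveHorn φ ∧ ¬ φ.Realize b (Fin.snoc y d)}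
  have hfail : ∀ φ ∈ F, ∃ q : ℕ × A, ¬ φ.Realize (fun j => (a j : ℕ → A) q.1)
      (Fin.snoc (fun j => (x j : ℕ → A) q.1) q.2) := by
    intro φ hφ
    obtain ⟨hφ, hφd⟩ := hF hφ
    by_contra! hall
    refine hφd (BoundedFormula.realize_all.1 (h φ.all hφ.all ?_) d)
    exact (hφ.all.realize_periodicPower_iff _ _).2 fun i =>
      BoundedFormula.realize_all.2 fun e => hall (i, e)
  choose! q hq using hfail
  obtain ⟨k, s, hk, hs, hrange⟩ := exists_periodic_range_eq
    ((hfin.image q).insert (0, Classical.arbitrary A)) (Set.insert_nonempty _ _)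
  obtain ⟨p, hp, hper⟩ := exists_common_period_of_finite (Sum.elim a x)
  -- On the `j`-th block of length `p`, the sequence `c` takes the value given by `s j`.
  refine ⟨⟨fun m => (s (m / p)).2, p * k, Nat.mul_pos hp hk, fun m => ?_⟩, ?_⟩
  · change (s (m / p)).2 = (s (m % (p * k) / p)).2
    rw [hs (m / p), Nat.mod_mul_right_div_self]
  · intro φ hφ hφc
    by_contra hφd
    obtain ⟨ψ, hψ, hiff⟩ := hrep φ ⟨hφ, hφd⟩
    obtain ⟨j, hj⟩ : q ψ ∈ Set.range s := hrange ▸ Or.inr ⟨ψ, hψ, rfl⟩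
    have hval := (hφ.realize_periodicPower_iff _ _).1 hφc ((q ψ).1 % p + p * j)
    rw [hiff, coe_snoc_periodicPower] at hval
    refine hq ψ hψ ?_
    have hmod : ((q ψ).1 % p + p * j) % p = (q ψ).1 % p := by simp
    have hdiv : ((q ψ).1 % p + p * j) / p = j := by
      rw [Nat.add_mul_div_left _ _ hp, Nat.div_eq_of_lt (Nat.mod_lt _ hp), zero_add]
    have ha : (fun j' => (a j' : ℕ → A) ((q ψ).1 % p + p * j)) =
        fun j' => (a j' : ℕ → A) (q ψ).1 :=
      funext fun j' => by
        have h1 := hper (Sum.inl j') ((q ψ).1 % p + p * j)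
        rw [hmod, ← hper (Sum.inl j')] at h1
        exact h1
    have hx : (fun j' => (x j' : ℕ → A) ((q ψ).1 % p + p * j)) =
        fun j' => (x j' : ℕ → A) (q ψ).1 :=
      funext fun j' => by
        have h1 := hper (Sum.inr j') ((q ψ).1 % p + p * j)
        rw [hmod, ← hper (Sum.inr j')] at h1
        exact h1
    rw [ha, hx] at hval
    simpa only [hdiv, hj] using hval

end

theorem countable_periodicPower [Countable A] : Countable (periodicPower L A) := by
  let f : (Σ k : ℕ, Fin (k + 1) → A) → periodicPower L A := fun p =>
    repeatFirst L (p.1 + 1) p.1.succ_pos fun i => p.2 (Fin.ofNat (p.1 + 1) i)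
  refine Function.Surjective.countable (f := f) ?_
  rintro ⟨c, k, hk, hc⟩
  obtain ⟨k, rfl⟩ := Nat.exists_eq_succ_of_ne_zero hk.ne'
  refine ⟨⟨k, fun i => c i⟩, Subtype.ext (funext fun i => ?_)⟩
  simpa [f, repeatFirst, Fin.ofNat] using (hc i).symm

/-- Back and forth: the pairs listed in a generic ideal of transferring tuples form the graph of a
surjective periomorphism. Only atomic formulas matter for this limit; well-definedness and
`h (a j) = b j` come from equalities between variables. -/
theorem HornTransfer.exists_surjective_periomorphism [Countable L.Symbols] [Nonempty A]
    (hA : IsAleph0Categorical L A) {r : ℕ} {a : Fin r → periodicPower L A} {b : Fin r → A}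
    {x₀ : Fin 0 → periodicPower L A} {y₀ : Fin 0 → A} (h : HornTransfer a b x₀ y₀) :
    ∃ h : Periomorphism L A, Function.Surjective h ∧ ∀ j, h (a j) = b j := by
  have : Countable A := hA.1
  have : Countable (periodicPower L A) := countable_periodicPower
  let P := {p : Σ n, (Fin n → periodicPower L A) × (Fin n → A) // HornTransfer a b p.2.1 p.2.2}
  let graph : P → Set (periodicPower L A × A) := fun p =>
    Set.range fun i => (p.1.2.1 i, p.1.2.2 i)
  let : Preorder P := Preorder.lift graph
  have hext : ∀ (p : P) (c : periodicPower L A) (d : A),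
      HornTransfer a b (Fin.snoc p.1.2.1 c : Fin (p.1.1 + 1) → _)
        (Fin.snoc p.1.2.2 d : Fin (p.1.1 + 1) → A) → ∃ q : P, p ≤ q ∧ (c, d) ∈ graph q := by
    intro p c d hcd
    refine ⟨⟨⟨p.1.1 + 1, Fin.snoc p.1.2.1 c, Fin.snoc p.1.2.2 d⟩, hcd⟩, ?_, Fin.last _, by simp⟩
    rintro _ ⟨i, rfl⟩
    exact ⟨i.castSucc, by simp⟩
  let : Encodable (periodicPower L A) := Encodable.ofCountable _
  let : Encodable A := Encodable.ofCountable A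
  let 𝒟 : periodicPower L A ⊕ A → Order.Cofinal P := Sum.elim
    (fun c => ⟨{p | ∃ d, (c, d) ∈ graph p}, fun p => by
      obtain ⟨d, hd⟩ := p.2.exists_snoc_right hA c
      obtain ⟨q, hpq, hq⟩ := hext p c d hd
      exact ⟨q, ⟨d, hq⟩, hpq⟩⟩)
    (fun d => ⟨{p | ∃ c, (c, d) ∈ graph p}, fun p => by
      obtain ⟨c, hc⟩ := p.2.exists_snoc_left hA d
      obtain ⟨q, hpq, hq⟩ := hext p c d hc
      exact ⟨q, ⟨c, hq⟩, hpq⟩⟩)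
  let I := Order.idealOfCofinals (⟨⟨0, x₀, y₀⟩, h⟩ : P) 𝒟
  have htotal : ∀ c, ∃ d, ∃ p ∈ I, (c, d) ∈ graph p := fun c => by
    obtain ⟨p, ⟨d, hd⟩, hp⟩ := Order.cofinal_meets_idealOfCofinals
      (⟨⟨0, x₀, y₀⟩, h⟩ : P) 𝒟 (Sum.inl c)
    exact ⟨d, p, hp, hd⟩
  have honto : ∀ d, ∃ c, ∃ p ∈ I, (c, d) ∈ graph p := fun d => by
    obtain ⟨p, ⟨c, hc⟩, hp⟩ := Order.cofinal_meets_idealOfCofinals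
      (⟨⟨0, x₀, y₀⟩, h⟩ : P) 𝒟 (Sum.inr d)
    exact ⟨c, p, hp, hc⟩
  -- By directedness, finitely many pairs of the limit relation occur in a single state.
  have hfin : ∀ (ι : Type) [Finite ι] (c : ι → periodicPower L A) (d : ι → A),
      (∀ i, ∃ p ∈ I, (c i, d i) ∈ graph p) →
        ∃ (p : P) (e : ι → Fin p.1.1), p.1.2.1 ∘ e = c ∧ p.1.2.2 ∘ e = d := by
    intro ι _ c d hcd
    choose p hpI hp using hcd
    obtain ⟨q, hq, hpq⟩ := exists_mem_ideal_forall_le I p hpI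
    choose e he using fun i => hpq i (hp i)
    exact ⟨q, e, funext fun i => congrArg Prod.fst (he i),
      funext fun i => congrArg Prod.snd (he i)⟩
  have hatom : ∀ {p : P} {φ : L.BoundedFormula (Fin r) p.1.1}, φ.IsAtomic →
      φ.Realize a p.1.2.1 → φ.Realize b p.1.2.2 := fun {p} _ hφ => p.2 _ (.atomic hφ)
  have hfun : ∀ c d d', (∃ p ∈ I, (c, d) ∈ graph p) → (∃ p ∈ I, (c, d') ∈ graph p) →
      d = d' := by
    intro c d d' hd hd'
    obtain ⟨p, e, hc, he⟩ := hfin (Fin 2) ![c, c] ![d, d'] (by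
      intro i; fin_cases i <;> assumption)
    have hc0 : p.1.2.1 (e 0) = c := congrFun hc 0
    have hc1 : p.1.2.1 (e 1) = c := congrFun hc 1
    have hd0 : p.1.2.2 (e 0) = d := congrFun he 0
    have hd1 : p.1.2.2 (e 1) = d' := congrFun he 1
    have := hatom (p := p) (.equal (Term.var (Sum.inr (e 0))) (Term.var (Sum.inr (e 1)))) (by
      simp [BoundedFormula.realize_bdEqual, hc0, hc1])
    simpa [BoundedFormula.realize_bdEqual, hd0, hd1] using this
  choose f hf using htotal
  refine ⟨⟨f, fun {n} g x => ?_, fun {n} R x hR => ?_⟩, fun d => ?_, fun j => ?_⟩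
  · obtain ⟨p, e, hc, he⟩ := hfin (Option (Fin n)) (fun o => o.elim (Structure.funMap g x) x)
      (fun o => o.elim (f (Structure.funMap g x)) (f ∘ x)) (by
        rintro (_ | i)
        · exact hf _
        · exact hf _)
    have hc0 := congrFun hc none
    have hc1 := fun i => congrFun hc (some i)
    have he0 := congrFun he none
    have he1 := fun i => congrFun he (some i)
    simp only [Function.comp_apply, Option.elim] at hc0 hc1 he0 he1
    have := hatom (p := p) (.equal (Term.var (Sum.inr (e none)))
      (Term.func g fun i => Term.var (Sum.inr (e (some i))))) (by
        simp [BoundedFormula.realize_bdEqual, hc0, hc1])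
    simpa [BoundedFormula.realize_bdEqual, he0, he1, Function.comp_def] using this
  · obtain ⟨p, e, hc, he⟩ := hfin (Fin n) x (f ∘ x) fun i => hf _
    have := hatom (p := p) (.rel R fun i => Term.var (Sum.inr (e i))) (by
      simpa [BoundedFormula.realize_rel, ← hc, Function.comp_def] using hR)
    simpa [BoundedFormula.realize_rel, ← he, Function.comp_def] using this
  · obtain ⟨c, hc⟩ := honto d
    exact ⟨c, hfun c _ _ (hf c) hc⟩
  · obtain ⟨p, -, ⟨i, hi⟩⟩ := hf (a j)
    have hc : p.1.2.1 i = a j := congrArg Prod.fst hi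
    have hd : p.1.2.2 i = f (a j) := congrArg Prod.snd hi
    have := hatom (p := p) (.equal (Term.var (Sum.inr i)) (Term.var (Sum.inl j))) (by
      simp [BoundedFormula.realize_bdEqual, hc])
    have hfb : f (a j) = b j := by simpa [BoundedFormula.realize_bdEqual, hd] using this
    exact hfb

/-! ### The preservation theorem -/

theorem positiveHornDefinable_of_preserves [Countable L.Symbols] [Nonempty A]
    (hA : IsAleph0Categorical L A) {r : ℕ} {R : Set (Fin r → A)}
    (hR : ∀ h : Periomorphism L A, Function.Surjective h → h.Preserves R) :
    PositiveHornDefinable L R := by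
  rcases R.eq_empty_or_nonempty with rfl | ⟨t₀, ht₀⟩
  · exact ⟨⊥, .falsum, fun a => by simp [FirstOrder.Language.Formula.Realize]⟩
  obtain ⟨θ, hθ, hiff⟩ := hA.exists_isPositiveHorn_realize_iff_forall
    {φ : L.Formula (Fin r) | IsPositiveHorn φ ∧ ∀ t ∈ R, φ.Realize t} fun φ hφ => hφ.1
  refine ⟨θ, hθ, fun b => ⟨fun hb => (hiff b default).2 fun φ hφ => hφ.2 b hb, fun hb => ?_⟩⟩
  -- `F` represents the positive Horn formulas not valid on `R`, `t` picks counterexamples.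
  obtain ⟨F, hF, hfin, hrep⟩ := hA.exists_finite_representatives
    {φ : L.Formula (Fin r) | IsPositiveHorn φ ∧ ∃ t ∈ R, ¬ φ.Realize t}
  have ht : ∀ φ ∈ F, ∃ t ∈ R, ¬ FirstOrder.Language.Formula.Realize φ t := fun φ hφ => (hF hφ).2
  choose! t htR ht using ht
  obtain ⟨k, s, hk, hs, hrange⟩ := exists_periodic_range_eq
    ((hfin.image t).insert t₀) (Set.insert_nonempty _ _)
  have hsR : ∀ i, s i ∈ R := fun i => by
    rcases hrange.subset ⟨i, rfl⟩ with h | ⟨φ, hφ, h⟩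
    · exact h ▸ ht₀
    · exact h ▸ htR φ hφ
  let a : Fin r → periodicPower L A := fun j => ⟨fun i => s i j, k, hk, fun i => congrFun (hs i) j⟩
  have htrans : HornTransfer (n := 0) a b default default := by
    intro φ hφ hφa
    refine (hiff b default).1 hb φ ⟨hφ, ?_⟩
    by_contra! hcon
    obtain ⟨ψ, hψ, hφψ⟩ := hrep φ ⟨hφ, hcon⟩
    obtain ⟨i, hi⟩ : t ψ ∈ Set.range s := hrange ▸ Or.inr ⟨ψ, hψ, rfl⟩
    have hval := (hφψ _ _).1 ((hφ.realize_periodicPower_iff _ _).1 hφa i)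
    refine ht ψ hψ ?_
    rw [← hi]
    exact (congrArg₂ ψ.Realize rfl (Subsingleton.elim _ _)).mp hval
  obtain ⟨h, hsurj, hab⟩ := htrans.exists_surjective_periomorphism hA
  have := hR h hsurj a hsR
  rwa [funext hab] at this

end PosHorn

theorem theorem6p1 (L : FirstOrder.Language.{u, v}) [Countable L.Symbols] (A : Type w) [L.Structure A]
    [Nonempty A] (hA : PosHorn.IsAleph0Categorical L A) (r : ℕ) (R : Set (Fin r → A)) :
    PosHorn.PositiveHornDefinable L R ↔
      ∀ h : PosHorn.Periomorphism L A, Function.Surjective h →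
        PosHorn.Periomorphism.Preserves h R :=
  ⟨fun hR h hh => hR.preserves h hh, PosHorn.positiveHornDefinable_of_preserves hA⟩
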